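/- Let $n\ge 2$. For $\alpha\in\mathbb R$, a representation $\pi\in\mathrm{Rep}\,\mathcal P_{n,\alpha}$ on a complex Hilbert space $H$ is an $n$-tuple of orthogonal projections $P_1,\dots,P_n$ on $H$ with $P_1+\cdots+P_n=\alpha I_H$. It is irreducible if $H\neq 0$ and $0$ and $H$ are the only closed subspaces invariant under all $P_i$. Two representations $(H;P_i)$ and $(\tilde H;\tilde P_i)$ are equivalent if there is a unitary $U:H\to\tilde H$ with $UP_i=\tilde P_iU$ for all $i$. For $n\ge 4$ put $$\Lambda_n^0=\Big\{0,\ 1+\tfrac1{n-1},\ 1+\tfrac1{(n-2)-\frac1{n-1}},\ 1+\tfrac{1}{(n-2)-\frac{1}{(n-2)-\frac1{n-1}}},\dots\Big\},$$ $$\Lambda_n^1=\Big\{1,\ 1+\tfrac1{n-2},\ 1+\tfrac1{(n-2)-\frac1{n-2}},\ 1+\tfrac{1}{(n-2)-\frac{1}{(n-2)-\frac1{n-2}}},\dots\Big\}.$$ The discrete spectrum is $\Lambda_n^0\cup\Lambda_n^1\cup(n-\Lambda_n^1)\cup(n-\Lambda_n^0)$ for $n\ge4$, it is $\{0,1,2\}$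 for $n=2$, and it is $\{0,1,\tfrac32,2,3\}$ for $n=3$. For $\pi=(H;P_1,\dots,P_n)\in\mathrm{Rep}\,\mathcal P_{n,\alpha}$ with $\alpha\ne0$, let $H_i=\operatorname{Im}P_i$, let $\Gamma_i:H_i\to H$ be the inclusions, let $\mathcal H=H_1\oplus\cdots\oplus H_n$ be the Hilbert direct sum and $\Gamma=(\Gamma_1\ \cdots\ \Gamma_n):\mathcal H\to H$. Let $Q_i$ be the coordinate projection of $\mathcal H$ onto its $i$-th summand, and let $P=\frac1\alpha\Gamma^*\Gamma$. These are orthogonal projections with $Q_1+\cdots+Q_n=I$ and $Q_iPQ_i=\frac1\alpha Q_i$; they form the representation $F(\pi)\in\mathrm{Rep}\,\mathcal P_{n,\mathrm{abo},1/\alpha}$. Its system of $n+1$ subspaces is $$S_{F(\pi)}=(\mathcal H;\,Q_1\mathcal H,\dots,Q_n\mathcal H,\,P\mathcal H).$$ A system $(K;K_1,\dots,K_m)$ of subspaces of a Hilbert space is transitive if every bounded operator $R$ on $K$ with $R(K_i)\subset K_i$ for all $i$ is a scalar multiple of the identity. Two systems $(K;K_1,\dots,K_m)$ and $(\tilde K;\tilde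 K_1,\dots,\tilde K_m)$ are isomorphic if there is a bounded operator $R:K\to\tilde K$ with bounded inverse such that $R(K_i)=\tilde K_i$ for all $i$. **Theorem.** (1) If $\alpha\neq0$ is in the discrete spectrum and $\pi\in\mathrm{Rep}\,\mathcal P_{n,\alpha}$ is irreducible, then $S_{F(\pi)}$ is transitive. (2) If $\alpha,\tilde\alpha\ne0$ are in the discrete spectrum (possibly equal) and $\pi\in\mathrm{Rep}\,\mathcal P_{n,\alpha}$, $\tilde\pi\in\mathrm{Rep}\,\mathcal P_{n,\tilde\alpha}$ are irreducible and inequivalent, then $S_{F(\pi)}$ and $S_{F(\tilde\pi)}$ are not isomorphic. -/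

import Mathlib

namespace SubspaceSystems

noncomputable section

universe u v

/-! ### Systems of subspaces -/

section Systems

variable {ι : Type*}
  {H : Type u} [NormedAddCommGroup H] [InnerProductSpace ℂ H]
  {H' : Type v} [NormedAddCommGroup H'] [InnerProductSpace ℂ H']

/-- The bounded endomorphisms of the system `(H; S i)`: the `R ∈ B(H)` with `R (S i) ⊆ S i`
for every `i`. -/
def systemEnd (S : ι → Submodule ℂ H) : Set (H →L[ℂ] H) :=
  {R | ∀ i, ∀ x ∈ S i, R x ∈ S i}

/-- A system is transitive when its only endomorphisms are the scalar operators. -/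
def IsTransitive (S : ι → Submodule ℂ H) : Prop :=
  systemEnd S = {R | ∃ c : ℂ, R = c • ContinuousLinearMap.id ℂ H}

/-- Two systems are isomorphic when some bounded, boundedly invertible operator maps each
subspace of the first onto the corresponding subspace of the second. -/
def SystemIso (S : ι → Submodule ℂ H) (S' : ι → Submodule ℂ H') : Prop :=
  ∃ R : H ≃L[ℂ] H', ∀ i, (S i).map (R.toLinearEquiv : H →ₗ[ℂ] H') = S' i

end Systems

/-! ### Representations of `P_{n,α}` -/

/-- A `*`-representation on `H` of the `*`-algebra generated by `p_1, …, p_n` with relations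
`p_k ^ 2 = p_k ^ * = p_k` and `p_1 + ⋯ + p_n = α e`. -/
structure PRep (n : ℕ) (α : ℝ) (H : Type u) [NormedAddCommGroup H] [InnerProductSpace ℂ H]
    [CompleteSpace H] where
  /-- the images of the generators -/
  P : Fin n → H →L[ℂ] H
  proj : ∀ i, IsStarProjection (P i)
  sum_eq : ∑ i, P i = (α : ℂ) • ContinuousLinearMap.id ℂ H

/-- A `*`-representation on `K` of the `*`-algebra generated by `q_1, …, q_n, p` with relations
`q_j ^ 2 = q_j ^ * = q_j`, `p ^ 2 = p ^ * = p`, `q_1 + ⋯ + q_n = e` and `q_j p q_j = τ q_j`. -/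
structure AboRep (n : ℕ) (τ : ℝ) (K : Type u) [NormedAddCommGroup K] [InnerProductSpace ℂ K]
    [CompleteSpace K] where
  /-- the images of the first `n` generators -/
  Q : Fin n → K →L[ℂ] K
  /-- the image of the last generator -/
  P : K →L[ℂ] K
  projQ : ∀ i, IsStarProjection (Q i)
  projP : IsStarProjection P
  sum_eq : ∑ i, Q i = ContinuousLinearMap.id ℂ K
  compress : ∀ i, Q i ∘L P ∘L Q i = (τ : ℂ) • Q i

/-- The system `(K; Q_1 K, …, Q_n K, P K)` of `n + 1` subspaces. -/
def AboRep.system {n : ℕ} {τ : ℝ} {K : Type u} [NormedAddCommGroup K] [InnerProductSpace ℂ K]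
    [CompleteSpace K] (ρ : AboRep n τ K) : Fin (n + 1) → Submodule ℂ K :=
  Fin.snoc (α := fun _ => Submodule ℂ K)
    (fun i => LinearMap.range (ρ.Q i : K →ₗ[ℂ] K)) (LinearMap.range (ρ.P : K →ₗ[ℂ] K))

namespace PRep

variable {n : ℕ} {α β : ℝ}
  {H : Type u} [NormedAddCommGroup H] [InnerProductSpace ℂ H] [CompleteSpace H]
  {H' : Type v} [NormedAddCommGroup H'] [InnerProductSpace ℂ H'] [CompleteSpace H']

/-- A representation is irreducible when its space is nonzero and has no closed invariant
subspaces besides `0` and itself. -/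
def IsIrreducible (π : PRep n α H) : Prop :=
  Nontrivial H ∧ ∀ K : Submodule ℂ H, IsClosed (K : Set H) →
    (∀ i, ∀ x ∈ K, π.P i x ∈ K) → K = ⊥ ∨ K = ⊤

/-- Unitary equivalence: a unitary operator intertwines the two families of projections. -/
def Equivalent (π : PRep n α H) (π' : PRep n β H') : Prop :=
  ∃ U : H ≃ₗᵢ[ℂ] H', ∀ i x, U (π.P i x) = π'.P i (U x)

/-- The subspace `H_i = Im P_i`. -/
def im (π : PRep n α H) (i : Fin n) : Submodule ℂ H :=
  LinearMap.range (π.P i : H →ₗ[ℂ] H)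

instance (π : PRep n α H) (i : Fin n) : CompleteSpace (π.im i) :=
  (ContinuousLinearMap.IsIdempotentElem.isClosed_range
    (π.proj i).isIdempotentElem).completeSpace_coe

/-- The Hilbert direct sum `H_1 ⊕ ⋯ ⊕ H_n`. -/
abbrev Sum (π : PRep n α H) : Type u := PiLp 2 (fun i : Fin n => π.im i)

/-- The operator `Γ = (Γ_1 … Γ_n) : H_1 ⊕ ⋯ ⊕ H_n → H`, where `Γ_i : H_i → H` is the
inclusion. -/
def Gam (π : PRep n α H) : π.Sum →L[ℂ] H :=
  ∑ i, (π.im i).subtypeL ∘L PiLp.proj 2 (fun i : Fin n => π.im i) i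

/-- The `i`-th coordinate projection `diag (0, …, 0, I, 0, …, 0)` on `H_1 ⊕ ⋯ ⊕ H_n`. -/
def coordProj (π : PRep n α H) (i : Fin n) : π.Sum →L[ℂ] π.Sum :=
  ((PiLp.continuousLinearEquiv 2 ℂ (fun i : Fin n => π.im i)).symm :
      (∀ i, π.im i) →L[ℂ] π.Sum) ∘L
    ContinuousLinearMap.single ℂ (fun i : Fin n => π.im i) i ∘L
      PiLp.proj 2 (fun i : Fin n => π.im i) i

/-- The operator `(1 / α) Γ^* Γ`. -/
def gramProj (π : PRep n α H) : π.Sum →L[ℂ] π.Sum :=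
  ((1 / α : ℝ) : ℂ) • (ContinuousLinearMap.adjoint π.Gam ∘L π.Gam)

theorem P_apply_of_mem (π : PRep n α H) (i : Fin n) (x : π.im i) : π.P i x = x := by
  obtain ⟨x, y, rfl⟩ := x
  exact congrArg (fun T : H →L[ℂ] H => T y) (π.proj i).isIdempotentElem

theorem inner_P (π : PRep n α H) (i : Fin n) (x y : H) :
    inner ℂ (π.P i x) y = inner ℂ x (π.P i y) :=
  (ContinuousLinearMap.isSelfAdjoint_iff_isSymmetric.mp (π.proj i).isSelfAdjoint) x y

theorem Gam_apply (π : PRep n α H) (x : π.Sum) : π.Gam x = ∑ i, (x i : H) := by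
  simp [Gam]

theorem coordProj_apply (π : PRep n α H) (i : Fin n) (x : π.Sum) (j : Fin n) :
    π.coordProj i x j = if j = i then x j else 0 := by
  by_cases h : j = i
  · subst h
    simp [coordProj]
  · simp [coordProj, h]

theorem adjoint_Gam_apply (π : PRep n α H) (x : H) (j : Fin n) :
    ((ContinuousLinearMap.adjoint π.Gam x j : π.im j) : H) = π.P j x := by
  have key : ContinuousLinearMap.adjoint π.Gam x
      = WithLp.toLp 2 (fun i => (⟨π.P i x, x, rfl⟩ : π.im i)) := by
    refine ext_inner_right ℂ fun y => ?_
    rw [ContinuousLinearMap.adjoint_inner_left, Gam_apply, inner_sum, PiLp.inner_apply]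
    refine Finset.sum_congr rfl fun i _ => ?_
    rw [Submodule.coe_inner, inner_P, P_apply_of_mem]
  rw [key]

theorem Gam_adjoint (π : PRep n α H) (x : H) :
    π.Gam (ContinuousLinearMap.adjoint π.Gam x) = (α : ℂ) • x := by
  rw [Gam_apply]
  simp only [adjoint_Gam_apply]
  simpa using congrArg (fun T : H →L[ℂ] H => T x) π.sum_eq

/-- The action on objects of the functor `F` from representations of `P_{n,α}` to representations
of the algebra with `q_1 + ⋯ + q_n = e` and `q_j p q_j = (1 / α) q_j`: the `q_i` go to the
coordinate projections on `H_1 ⊕ ⋯ ⊕ H_n`, and `p` goes to `(1 / α) Γ^* Γ`. -/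
def functorF (π : PRep n α H) (hα : α ≠ 0) : AboRep n (1 / α) π.Sum where
  Q := π.coordProj
  P := π.gramProj
  projQ i := by
    constructor
    · refine ContinuousLinearMap.ext fun x => PiLp.ext fun j => ?_
      rw [mul_apply_eq_comp, coordProj_apply, coordProj_apply]
      split_ifs <;> rfl
    · rw [ContinuousLinearMap.isSelfAdjoint_iff_isSymmetric]
      intro x y
      simp only [ContinuousLinearMap.coe_coe, PiLp.inner_apply, coordProj_apply]
      refine Finset.sum_congr rfl fun j _ => ?_
      split_ifs <;> simp
  projP := by
    have hc : (α : ℂ) ≠ 0 := by exact_mod_cast hα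
    constructor
    · refine ContinuousLinearMap.ext fun x => ?_
      simp only [gramProj, mul_apply_eq_comp, _root_.smul_apply,
        ContinuousLinearMap.comp_apply, map_smul, Gam_adjoint, smul_smul]
      congr 1
      push_cast
      field_simp
    · rw [ContinuousLinearMap.isSelfAdjoint_iff_isSymmetric]
      intro x y
      simp only [gramProj, ContinuousLinearMap.coe_coe, _root_.smul_apply,
        ContinuousLinearMap.comp_apply, inner_smul_left, inner_smul_right,
        ContinuousLinearMap.adjoint_inner_left, ContinuousLinearMap.adjoint_inner_right,
        Complex.conj_ofReal]
  sum_eq := by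
    refine ContinuousLinearMap.ext fun x => PiLp.ext fun j => ?_
    rw [_root_.sum_apply, WithLp.ofLp_sum, Finset.sum_apply]
    simp [coordProj_apply]
  compress i := by
    refine ContinuousLinearMap.ext fun x => PiLp.ext fun j => ?_
    simp only [ContinuousLinearMap.comp_apply, _root_.smul_apply, coordProj_apply,
      PiLp.smul_apply]
    split_ifs with h
    · subst h
      refine Subtype.ext ?_
      have hG : π.Gam (π.coordProj j x) = x j := by
        rw [Gam_apply]
        simp only [coordProj_apply]
        rw [Finset.sum_eq_single j] <;> simp +contextual
      simp only [gramProj, _root_.smul_apply, ContinuousLinearMap.comp_apply,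
        PiLp.smul_apply, Submodule.coe_smul, adjoint_Gam_apply, hG, P_apply_of_mem]
    · simp

end PRep

/-! ### The discrete spectrum -/

/-- The finite continued fractions `b`, `(n - 2) - 1 / b`, `(n - 2) - 1 / ((n - 2) - 1 / b)`, … -/
def contFrac (n : ℕ) (b : ℝ) : ℕ → ℝ
  | 0 => b
  | k + 1 => ((n : ℝ) - 2) - 1 / contFrac n b k

/-- `Λ_n^0 = {0, 1 + 1/(n-1), 1 + 1/((n-2) - 1/(n-1)), …}`. -/
def Lambda0 (n : ℕ) : Set ℝ :=
  {0} ∪ Set.range fun k => 1 + 1 / contFrac n ((n : ℝ) - 1) k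

/-- `Λ_n^1 = {1, 1 + 1/(n-2), 1 + 1/((n-2) - 1/(n-2)), …}`. -/
def Lambda1 (n : ℕ) : Set ℝ :=
  {1} ∪ Set.range fun k => 1 + 1 / contFrac n ((n : ℝ) - 2) k

/-- The discrete spectrum for `n` projections, `n ≥ 2`. For `n = 2, 3` it consists of all the
`α` for which `P_{n,α}` has a representation. -/
def discreteSpectrum (n : ℕ) : Set ℝ :=
  if n = 2 then {0, 1, 2}
  else if n = 3 then {0, 1, 3 / 2, 2, 3}
  else {α | α ∈ Lambda0 n ∨ α ∈ Lambda1 n ∨ (n : ℝ) - α ∈ Lambda1 n ∨ (n : ℝ) - α ∈ Lambda0 n}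

end

end SubspaceSystems

/-!
The proof rests on two facts.

*Operators.* A morphism `R` of the systems of `F(π)` and `F(π')` preserves the range of `Γ^*`, so it
comes from an operator `A : H → H'` with `Γ'^* A = R Γ^*`, and since `R` is block diagonal,
`P'_i A = P'_i A P_i` (`exists_lift`). In finite dimension, put `D_i = P'_i A - A P_i`. Expanding and
using cyclicity of the trace, `tr (D_i^* D_i) = tr (A^* A P_i) - tr (A^* P'_i A)`, and summing over
`i` gives `∑ tr (D_i^* D_i) = (α - β) tr (A^* A)` (`sum_trace_defect`). So a nonzero `A` forces
`β ≤ α`, and for `α = β` all `D_i` vanish: `A` intertwines the representations. For `π = π'`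
irreducible, Schur's lemma makes `A`, hence `R`, a scalar. If `R` is an isomorphism, using its
inverse as well gives `α = β`, and the intertwiner `A` is a multiple of a unitary.

*Finite-dimensionality.* The discrete spectrum enters only through the fact that irreducible
representations with these parameters are finite-dimensional. This follows from the property that
every nonzero representation has a nonzero finite-dimensional invariant subspace
(`HasFiniteInvariant`). It is clear for `α = 0, 1`, and it is transported along `α ↦ n - α` (replace
`P_i` by `I - P_i`) and from `α / (α - 1)` to `α` (the hyperbolic reflection, `refl`: compress the
coordinate projections of `H_1 ⊕ ⋯ ⊕ H_n` to the kernel of `Γ`). The composite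
`α ↦ 1 + 1 / (n - 1 - α)` generates the continued fractions of the discrete spectrum from `0`
and `1`.
-/

namespace SubspaceSystems

universe u v

theorem SystemIso.symm {ι : Type*} {H : Type u} [NormedAddCommGroup H] [InnerProductSpace ℂ H]
    {H' : Type v} [NormedAddCommGroup H'] [InnerProductSpace ℂ H'] {S : ι → Submodule ℂ H}
    {S' : ι → Submodule ℂ H'} (h : SystemIso S S') : SystemIso S' S := by
  obtain ⟨R, hR⟩ := h
  refine ⟨R.symm, fun i => ?_⟩
  rw [← hR i, ← Submodule.map_comp]
  convert Submodule.map_id (S i)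
  ext x
  simp

namespace PRep

open ContinuousLinearMap

/-! ### Operators between finite-dimensional representations -/

section FiniteDimensional

variable {n : ℕ} {α β : ℝ}
  {H : Type u} [NormedAddCommGroup H] [InnerProductSpace ℂ H] [CompleteSpace H]
  {H' : Type v} [NormedAddCommGroup H'] [InnerProductSpace ℂ H'] [CompleteSpace H']

theorem re_trace_adjoint_comp_self [FiniteDimensional ℂ H] {ι : Type*} [Fintype ι]
    (b : OrthonormalBasis ι ℂ H) (D : H →L[ℂ] H') :
    (LinearMap.trace ℂ H (adjoint D ∘L D : H →L[ℂ] H)).re = ∑ k, ‖D (b k)‖ ^ 2 := by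
  rw [LinearMap.trace_eq_sum_inner _ b, Complex.re_sum]
  refine Finset.sum_congr rfl fun k _ => ?_
  rw [coe_coe, comp_apply, adjoint_inner_right]
  exact inner_self_eq_norm_sq (𝕜 := ℂ) (D (b k))

theorem re_trace_adjoint_comp_self_nonneg [FiniteDimensional ℂ H] (D : H →L[ℂ] H') :
    0 ≤ (LinearMap.trace ℂ H (adjoint D ∘L D : H →L[ℂ] H)).re := by
  rw [re_trace_adjoint_comp_self (stdOrthonormalBasis ℂ H)]
  positivity

theorem eq_zero_of_re_trace_adjoint_comp_self [FiniteDimensional ℂ H] (D : H →L[ℂ] H')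
    (h : (LinearMap.trace ℂ H (adjoint D ∘L D : H →L[ℂ] H)).re = 0) : D = 0 := by
  rw [re_trace_adjoint_comp_self (stdOrthonormalBasis ℂ H),
    Finset.sum_eq_zero_iff_of_nonneg fun _ _ => by positivity] at h
  refine coe_injective ((stdOrthonormalBasis ℂ H).toBasis.ext fun k => ?_)
  simpa using h k (Finset.mem_univ k)

/-- When `A` maps `ker P` into `ker P'`, the Hilbert–Schmidt norm of `P' A - A P` measures the
failure of `A` to intertwine `P` and `P'`, and it is linear in `P` and `P'`. -/
theorem trace_defect [FiniteDimensional ℂ H] {P : H →L[ℂ] H} {P' : H' →L[ℂ] H'}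
    (hP : IsStarProjection P) (hP' : IsStarProjection P') (A : H →L[ℂ] H')
    (h : P' ∘L A = P' ∘L A ∘L P) :
    LinearMap.trace ℂ H (adjoint (P' ∘L A - A ∘L P) ∘L (P' ∘L A - A ∘L P) : H →L[ℂ] H) =
      LinearMap.trace ℂ H (adjoint A ∘L A ∘L P : H →L[ℂ] H) -
        LinearMap.trace ℂ H (adjoint A ∘L P' ∘L A : H →L[ℂ] H) := by
  have hPa : adjoint P = P := hP.isSelfAdjoint.adjoint_eq
  have hPa' : adjoint P' = P' := hP'.isSelfAdjoint.adjoint_eq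
  have hPP : P ∘L P = P := hP.isIdempotentElem
  have hPP' : P' ∘L P' = P' := hP'.isIdempotentElem
  have h' : adjoint A ∘L P' = P ∘L adjoint A ∘L P' := by
    have := congrArg adjoint h
    simpa only [adjoint_comp, hPa, hPa', comp_assoc] using this
  have key : adjoint (P' ∘L A - A ∘L P) ∘L (P' ∘L A - A ∘L P) =
      P ∘L (adjoint A ∘L A ∘L P) - adjoint A ∘L P' ∘L A := by
    have e1 : adjoint A ∘L P' ∘L P' ∘L A = adjoint A ∘L P' ∘L A := by
      rw [← comp_assoc P', hPP']
    have e2 : P ∘L adjoint A ∘L P' ∘L A = adjoint A ∘L P' ∘L A := by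
      rw [← comp_assoc (adjoint A) P', ← comp_assoc P, ← h', comp_assoc]
    simp only [map_sub, adjoint_comp, hPa, hPa', comp_sub, sub_comp, comp_assoc, e1, e2, ← h]
    abel
  have hcyc : LinearMap.trace ℂ H (P ∘L (adjoint A ∘L A ∘L P) : H →L[ℂ] H) =
      LinearMap.trace ℂ H (adjoint A ∘L A ∘L P : H →L[ℂ] H) := by
    have := LinearMap.trace_mul_comm ℂ (P : H →ₗ[ℂ] H) (adjoint A ∘L A ∘L P : H →L[ℂ] H)
    refine this.trans (congrArg (LinearMap.trace ℂ H) ?_)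
    ext x
    exact congrArg (fun T : H →L[ℂ] H => adjoint A (A (T x))) hPP
  rw [key, ← hcyc, toLinearMap_sub, map_sub]

/-- Summing over the generators replaces the projections by the scalars `α` and `β`. -/
theorem sum_trace_defect [FiniteDimensional ℂ H] (π : PRep n α H) (π' : PRep n β H')
    (A : H →L[ℂ] H') (h : ∀ i, π'.P i ∘L A = π'.P i ∘L A ∘L π.P i) :
    ∑ i, (LinearMap.trace ℂ H (adjoint (π'.P i ∘L A - A ∘L π.P i) ∘L
        (π'.P i ∘L A - A ∘L π.P i) : H →L[ℂ] H)).re =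
      (α - β) * (LinearMap.trace ℂ H (adjoint A ∘L A : H →L[ℂ] H)).re := by
  have h1 : ∑ i, (adjoint A ∘L A ∘L π.P i : H →L[ℂ] H) = (α : ℂ) • (adjoint A ∘L A) := by
    rw [← comp_finsetSum, ← comp_finsetSum, π.sum_eq]
    ext x; simp
  have h2 : ∑ i, (adjoint A ∘L π'.P i ∘L A : H →L[ℂ] H) = (β : ℂ) • (adjoint A ∘L A) := by
    rw [← comp_finsetSum, ← finsetSum_comp, π'.sum_eq]
    ext x; simp
  have h3 : ∀ T : Fin n → H →L[ℂ] H, ∑ i, LinearMap.trace ℂ H (T i : H →ₗ[ℂ] H) =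
      LinearMap.trace ℂ H ((∑ i, T i : H →L[ℂ] H) : H →ₗ[ℂ] H) := by
    intro T
    rw [toLinearMap_sum, map_sum]
  rw [← Complex.re_sum, Finset.sum_congr rfl fun i _ => trace_defect (π.proj i) (π'.proj i) A (h i),
    Finset.sum_sub_distrib, h3, h3, h1, h2, toLinearMap_smul, toLinearMap_smul, map_smul, map_smul,
    ← sub_smul, ← Complex.ofReal_sub, smul_eq_mul, Complex.re_ofReal_mul]

/-- A nonzero `A` with `A (ker P_i) ⊆ ker P'_i` for all `i` can only go from a larger to a smaller
parameter. -/
theorem le_of_comp_eq [FiniteDimensional ℂ H] (π : PRep n α H) (π' : PRep n β H')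
    {A : H →L[ℂ] H'} (hA : A ≠ 0) (h : ∀ i, π'.P i ∘L A = π'.P i ∘L A ∘L π.P i) : β ≤ α := by
  have h0 := re_trace_adjoint_comp_self_nonneg A
  have hpos := h0.lt_of_ne' fun h0 => hA (eq_zero_of_re_trace_adjoint_comp_self A h0)
  have hs := sum_trace_defect π π' A h
  have : 0 ≤ (α - β) * (LinearMap.trace ℂ H (adjoint A ∘L A : H →L[ℂ] H)).re :=
    hs ▸ Finset.sum_nonneg fun i _ => re_trace_adjoint_comp_self_nonneg _
  linarith [nonneg_of_mul_nonneg_left this hpos]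

/-- For equal parameters, an operator mapping each `ker P_i` into `ker P'_i` automatically
intertwines the two representations. -/
theorem intertwines_of_comp_eq [FiniteDimensional ℂ H] (π : PRep n α H) (π' : PRep n α H')
    {A : H →L[ℂ] H'} (h : ∀ i, π'.P i ∘L A = π'.P i ∘L A ∘L π.P i) (i : Fin n) :
    π'.P i ∘L A = A ∘L π.P i := by
  have hs := sum_trace_defect π π' A h
  rw [sub_self, zero_mul,
    Finset.sum_eq_zero_iff_of_nonneg fun i _ => re_trace_adjoint_comp_self_nonneg _] at hs
  exact sub_eq_zero.mp (eq_zero_of_re_trace_adjoint_comp_self _ (hs i (Finset.mem_univ i)))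

/-- Schur's lemma. -/
theorem IsIrreducible.eq_smul_of_commute [FiniteDimensional ℂ H] {π : PRep n α H}
    (hπ : π.IsIrreducible) {A : H →L[ℂ] H} (h : ∀ i, π.P i ∘L A = A ∘L π.P i) :
    ∃ c : ℂ, A = c • ContinuousLinearMap.id ℂ H := by
  have := hπ.1
  obtain ⟨c, hc⟩ := Module.End.exists_eigenvalue (A : H →ₗ[ℂ] H)
  refine ⟨c, ?_⟩
  have htop := (hπ.2 (Module.End.eigenspace (A : H →ₗ[ℂ] H) c)
    (Submodule.closed_of_finiteDimensional _) fun i x hx => ?_).resolve_left hc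
  · refine ContinuousLinearMap.ext fun x => ?_
    exact Module.End.mem_eigenspace_iff.mp (htop ▸ Submodule.mem_top : x ∈ _)
  · rw [Module.End.mem_eigenspace_iff] at hx ⊢
    have h1 : A x = c • x := hx
    have h2 : π.P i (A x) = A (π.P i x) := congrArg (fun T : H →L[ℂ] H => T x) (h i)
    rw [coe_coe, ← h2, h1, map_smul]

/-- A nonzero intertwiner of irreducible representations is a multiple of a unitary, because
`A^* A` is a scalar by Schur's lemma. -/
theorem equivalent_of_intertwines [FiniteDimensional ℂ H] {π : PRep n α H} {π' : PRep n β H'}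
    (hπ : π.IsIrreducible) (hπ' : π'.IsIrreducible) {A : H →L[ℂ] H'} (hA : A ≠ 0)
    (h : ∀ i, π'.P i ∘L A = A ∘L π.P i) : π.Equivalent π' := by
  have h' : ∀ i, π.P i ∘L adjoint A = adjoint A ∘L π'.P i := by
    intro i
    have := congrArg adjoint (h i)
    rw [adjoint_comp, adjoint_comp, (π.proj i).isSelfAdjoint.adjoint_eq,
      (π'.proj i).isSelfAdjoint.adjoint_eq] at this
    exact this.symm
  obtain ⟨c, hc⟩ := hπ.eq_smul_of_commute (A := adjoint A ∘L A) fun i => by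
    rw [← comp_assoc, h', comp_assoc, h, comp_assoc]
  have happ : ∀ i x, π'.P i (A x) = A (π.P i x) := fun i x =>
    congrArg (fun T : H →L[ℂ] H' => T x) (h i)
  have hin : ∀ x y, inner ℂ (A x) (A y) = c * inner ℂ x y := by
    intro x y
    rw [← adjoint_inner_right, ← comp_apply, hc]
    simp [inner_smul_right]
  obtain ⟨x₀, hx₀⟩ : ∃ x, A x ≠ 0 := by
    by_contra! h0
    exact hA (ContinuousLinearMap.ext h0)
  have hnorm : ∀ x, ‖A x‖ ^ 2 = c.re * ‖x‖ ^ 2 := by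
    intro x
    have := congrArg Complex.re (hin x x)
    rw [inner_self_eq_norm_sq_to_K, inner_self_eq_norm_sq_to_K] at this
    simpa [← Complex.ofReal_pow] using this
  have hcpos : 0 < c.re := by
    have h1 := hnorm x₀
    have h2 : 0 < ‖A x₀‖ ^ 2 := by positivity
    by_contra! h3
    nlinarith [sq_nonneg ‖x₀‖]
  have hsq : 0 < Real.sqrt c.re := Real.sqrt_pos.mpr hcpos
  have hrange : LinearMap.range (A : H →ₗ[ℂ] H') = ⊤ := by
    refine (hπ'.2 _ (Submodule.closed_of_finiteDimensional _) ?_).resolve_left fun hbot => ?_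
    · rintro i _ ⟨x, rfl⟩
      exact ⟨π.P i x, (happ i x).symm⟩
    · exact hx₀ ((Submodule.mem_bot ℂ).mp (hbot ▸ LinearMap.mem_range_self (A : H →ₗ[ℂ] H') x₀))
  let U : H →ₗᵢ[ℂ] H' :=
    { toLinearMap := ((Real.sqrt c.re)⁻¹ : ℂ) • (A : H →ₗ[ℂ] H')
      norm_map' := fun x => by
        have : ‖A x‖ = Real.sqrt c.re * ‖x‖ := by
          rw [← Real.sqrt_sq (norm_nonneg (A x)), hnorm, Real.sqrt_mul hcpos.le,
            Real.sqrt_sq (norm_nonneg x)]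
        rw [LinearMap.smul_apply, norm_smul, coe_coe, this, norm_inv, Complex.norm_real,
          Real.norm_of_nonneg hsq.le, inv_mul_cancel_left₀ hsq.ne'] }
  have hU : ∀ x, U x = ((Real.sqrt c.re)⁻¹ : ℂ) • A x := fun _ => rfl
  have hsurj : Function.Surjective U := by
    intro y
    obtain ⟨x, hx⟩ : y ∈ LinearMap.range (A : H →ₗ[ℂ] H') := hrange ▸ Submodule.mem_top
    refine ⟨(Real.sqrt c.re : ℂ) • x, ?_⟩
    have hne : (Real.sqrt c.re : ℂ) ≠ 0 := by exact_mod_cast hsq.ne'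
    rw [hU, map_smul, inv_smul_smul₀ hne]
    exact hx
  refine ⟨LinearIsometryEquiv.ofSurjective U hsurj, fun i x => ?_⟩
  rw [LinearIsometryEquiv.coe_ofSurjective, hU, hU, map_smul, happ]

end FiniteDimensional

/-! ### Morphisms of the systems of `F(π)` -/

section Lift

variable {n : ℕ} {α β : ℝ}
  {H : Type u} [NormedAddCommGroup H] [InnerProductSpace ℂ H] [CompleteSpace H]
  {H' : Type v} [NormedAddCommGroup H'] [InnerProductSpace ℂ H'] [CompleteSpace H']

theorem system_castSucc (π : PRep n α H) (hα : α ≠ 0) (i : Fin n) :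
    (π.functorF hα).system i.castSucc = LinearMap.range (π.coordProj i : π.Sum →ₗ[ℂ] π.Sum) := by
  simp [AboRep.system, functorF]

theorem system_last (π : PRep n α H) (hα : α ≠ 0) :
    (π.functorF hα).system (Fin.last n) =
      LinearMap.range (adjoint π.Gam : H →ₗ[ℂ] π.Sum) := by
  have hc : (α : ℂ) ≠ 0 := by exact_mod_cast hα
  have h : (π.functorF hα).system (Fin.last n) =
      LinearMap.range (π.gramProj : π.Sum →ₗ[ℂ] π.Sum) := by
    simp [AboRep.system, functorF]
  rw [h]
  apply le_antisymm
  · rintro _ ⟨x, rfl⟩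
    exact ⟨((1 / α : ℝ) : ℂ) • π.Gam x, by simp [gramProj]⟩
  · rintro _ ⟨x, rfl⟩
    refine ⟨adjoint π.Gam x, ?_⟩
    rw [coe_coe, gramProj, smul_apply, comp_apply, Gam_adjoint, map_smul, smul_smul]
    simp [hc]

theorem coordProj_coordProj (π : PRep n α H) (i j : Fin n) (x : π.Sum) :
    π.coordProj i (π.coordProj j x) = if i = j then π.coordProj i x else 0 := by
  refine PiLp.ext fun k => ?_
  split_ifs with h
  · subst h
    simp only [coordProj_apply]
    split_ifs <;> rfl
  · simp only [coordProj_apply, PiLp.zero_apply]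
    grind

theorem sum_coordProj (π : PRep n α H) (x : π.Sum) : ∑ i, π.coordProj i x = x := by
  refine PiLp.ext fun j => ?_
  rw [WithLp.ofLp_sum, Finset.sum_apply]
  simp [coordProj_apply]

/-- An operator that maps each summand into the corresponding one is block diagonal. -/
theorem coordProj_comm (π : PRep n α H) (π' : PRep n β H') {R : π.Sum →L[ℂ] π'.Sum}
    (hR : ∀ i x, R (π.coordProj i x) ∈ LinearMap.range (π'.coordProj i : π'.Sum →ₗ[ℂ] π'.Sum))
    (i : Fin n) (x : π.Sum) : π'.coordProj i (R x) = R (π.coordProj i x) := by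
  conv_lhs => rw [← π.sum_coordProj x, map_sum, map_sum]
  rw [Finset.sum_eq_single i]
  · obtain ⟨y, hy⟩ := hR i x
    rw [← hy, coe_coe, coordProj_coordProj, if_pos rfl]
  · intro j _ hj
    obtain ⟨y, hy⟩ := hR j x
    rw [← hy, coe_coe, coordProj_coordProj, if_neg hj.symm]
  · simp

/-- A morphism `R` of the systems of `F(π)` and `F(π')` preserves the range of `Γ^*`, hence is
induced by an operator `A : H → H'`; since `R` is block diagonal, `A` maps `ker P_i` into
`ker P'_i`. The last condition is stated as `P'_i A = P'_i A P_i`. -/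
theorem exists_lift (π : PRep n α H) (π' : PRep n β H') (hα : α ≠ 0) (hβ : β ≠ 0)
    {R : π.Sum →L[ℂ] π'.Sum}
    (hR : ∀ k, ∀ x ∈ (π.functorF hα).system k, R x ∈ (π'.functorF hβ).system k) :
    ∃ A : H →L[ℂ] H', (∀ x, adjoint π'.Gam (A x) = R (adjoint π.Gam x)) ∧
      ∀ i, π'.P i ∘L A = π'.P i ∘L A ∘L π.P i := by
  have hc : (β : ℂ) ≠ 0 := by exact_mod_cast hβ
  have hQ : ∀ i x, π'.coordProj i (R x) = R (π.coordProj i x) :=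
    coordProj_comm π π' fun i x => by
      rw [← system_castSucc π' hβ]
      apply hR
      rw [system_castSucc]
      exact ⟨x, rfl⟩
  let A : H →L[ℂ] H' := (β : ℂ)⁻¹ • (π'.Gam ∘L R ∘L adjoint π.Gam)
  have hA : ∀ x, adjoint π'.Gam (A x) = R (adjoint π.Gam x) := by
    intro x
    have := hR (Fin.last n) (adjoint π.Gam x) (by rw [system_last]; exact ⟨x, rfl⟩)
    rw [system_last] at this
    obtain ⟨y, hy⟩ := this
    have hy' : adjoint π'.Gam y = R (adjoint π.Gam x) := hy
    have : A x = y := by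
      simp only [A, smul_apply, comp_apply]
      rw [← hy', Gam_adjoint, inv_smul_smul₀ hc]
    rw [this, hy']
  refine ⟨A, hA, fun i => ContinuousLinearMap.ext fun x => ?_⟩
  -- `P'_i A x` is the `i`-th coordinate of `R Γ^* x`, so it depends only on `P_i x`.
  have hPA : ∀ x, π'.P i (A x) = (R (π.coordProj i (adjoint π.Gam x)) i : π'.im i) := by
    intro x
    rw [← adjoint_Gam_apply, hA, ← hQ, coordProj_apply, if_pos rfl]
  have hQP : π.coordProj i (adjoint π.Gam x) = π.coordProj i (adjoint π.Gam (π.P i x)) := by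
    refine PiLp.ext fun j => ?_
    simp only [coordProj_apply]
    split_ifs with hj
    · subst hj
      refine Subtype.ext ?_
      rw [adjoint_Gam_apply, adjoint_Gam_apply]
      exact (congrArg (fun T : H →L[ℂ] H => T x) (π.proj j).isIdempotentElem).symm
    · rfl
  simp only [comp_apply]
  rw [hPA, hPA, hQP]

theorem adjoint_Gam_injective (π : PRep n α H) (hα : α ≠ 0) :
    Function.Injective (adjoint π.Gam) := by
  have hc : (α : ℂ) ≠ 0 := by exact_mod_cast hα
  intro x y h
  have := congrArg π.Gam h
  rw [Gam_adjoint, Gam_adjoint] at this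
  exact smul_right_injective H hc this

theorem IsIrreducible.isTransitive [FiniteDimensional ℂ H] {π : PRep n α H}
    (hπ : π.IsIrreducible) (hα : α ≠ 0) : IsTransitive (π.functorF hα).system := by
  refine Set.Subset.antisymm (fun R hR => ?_) ?_
  · obtain ⟨A, hA, hP⟩ := exists_lift π π hα hα hR
    obtain ⟨c, rfl⟩ := hπ.eq_smul_of_commute (intertwines_of_comp_eq π π hP)
    have hQ : ∀ i x, π.coordProj i (R x) = R (π.coordProj i x) :=
      coordProj_comm π π fun i x => by
        rw [← system_castSucc π hα]
        apply hR
        rw [system_castSucc]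
        exact ⟨x, rfl⟩
    refine ⟨c, ContinuousLinearMap.ext fun x => ?_⟩
    -- Every vector of the `i`-th summand is `Q_i Γ^* y` for some `y`, so `R Γ^* = c Γ^*` suffices.
    have hx : ∀ i, π.coordProj i x = π.coordProj i (adjoint π.Gam (x i)) := by
      intro i
      refine PiLp.ext fun j => ?_
      simp only [coordProj_apply]
      split_ifs with hj
      · subst hj
        exact Subtype.ext (by rw [adjoint_Gam_apply, P_apply_of_mem])
      · rfl
    have hi : ∀ i, R (π.coordProj i x) = c • π.coordProj i x := by
      intro i
      rw [hx, ← hQ, ← hA]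
      simp
    rw [← π.sum_coordProj x, map_sum, map_sum]
    refine Finset.sum_congr rfl fun i _ => ?_
    rw [hi]
    simp
  · rintro _ ⟨c, rfl⟩ k x hx
    exact Submodule.smul_mem _ c hx

theorem exists_ne_zero_of_systemIso [Nontrivial H] {π : PRep n α H} {π' : PRep n β H'}
    {hα : α ≠ 0} {hβ : β ≠ 0} (h : SystemIso (π.functorF hα).system (π'.functorF hβ).system) :
    ∃ A : H →L[ℂ] H', A ≠ 0 ∧ ∀ i, π'.P i ∘L A = π'.P i ∘L A ∘L π.P i := by
  obtain ⟨R, hR⟩ := h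
  obtain ⟨A, hA, hP⟩ := exists_lift π π' hα hβ (R := (R : π.Sum →L[ℂ] π'.Sum))
    fun k x hx => hR k ▸ Submodule.mem_map_of_mem hx
  refine ⟨A, ?_, hP⟩
  rintro rfl
  obtain ⟨x, hx⟩ := exists_ne (0 : H)
  have h0 : R (adjoint π.Gam x) = 0 := by simpa using (hA x).symm
  rw [EmbeddingLike.map_eq_zero_iff] at h0
  exact hx (π.adjoint_Gam_injective hα (h0.trans (map_zero _).symm))

theorem equivalent_of_systemIso [FiniteDimensional ℂ H] [FiniteDimensional ℂ H']
    {π : PRep n α H} {π' : PRep n β H'} (hπ : π.IsIrreducible) (hπ' : π'.IsIrreducible)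
    {hα : α ≠ 0} {hβ : β ≠ 0} (h : SystemIso (π.functorF hα).system (π'.functorF hβ).system) :
    π.Equivalent π' := by
  have := hπ.1
  have := hπ'.1
  obtain ⟨A, hA, hP⟩ := exists_ne_zero_of_systemIso h
  obtain ⟨B, hB, hP'⟩ := exists_ne_zero_of_systemIso h.symm
  obtain rfl : α = β := le_antisymm (le_of_comp_eq π' π hB hP') (le_of_comp_eq π π' hA hP)
  exact equivalent_of_intertwines hπ hπ' hA (intertwines_of_comp_eq π π' hP)

end Lift
section FiniteInvariant

/-! ### Finite-dimensional invariant subspaces -/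

/-- Every representation of `P_{n,α}` on a nonzero Hilbert space has a nonzero finite-dimensional
invariant subspace. Unlike finite-dimensionality of the irreducible representations, this makes no
reference to irreducibility, which is what lets it pass through the reflection functors. -/
def HasFiniteInvariant (n : ℕ) (α : ℝ) : Prop :=
  ∀ (H : Type u) [NormedAddCommGroup H] [InnerProductSpace ℂ H] [CompleteSpace H],
    Nontrivial H → ∀ π : PRep n α H, ∃ L : Submodule ℂ H, L ≠ ⊥ ∧ FiniteDimensional ℂ L ∧
      ∀ i, ∀ x ∈ L, π.P i x ∈ L

variable {n : ℕ} {α : ℝ}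
  {H : Type u} [NormedAddCommGroup H] [InnerProductSpace ℂ H] [CompleteSpace H]

theorem HasFiniteInvariant.finiteDimensional (h : HasFiniteInvariant.{u} n α) {π : PRep n α H}
    (hπ : π.IsIrreducible) : FiniteDimensional ℂ H := by
  obtain ⟨L, hL, hfin, hinv⟩ := h H hπ.1 π
  obtain rfl : L = ⊤ := (hπ.2 L L.closed_of_finiteDimensional hinv).resolve_left hL
  exact Module.Finite.equiv (Submodule.topEquiv (R := ℂ) (M := H))

theorem exists_invariant_line (π : PRep n α H) {x : H} (hx : x ≠ 0)
    (h : ∀ i, ∃ c : ℂ, π.P i x = c • x) :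
    ∃ L : Submodule ℂ H, L ≠ ⊥ ∧ FiniteDimensional ℂ L ∧ ∀ i, ∀ x ∈ L, π.P i x ∈ L := by
  refine ⟨ℂ ∙ x, by simpa using hx, inferInstance, fun i y hy => ?_⟩
  obtain ⟨a, rfl⟩ := Submodule.mem_span_singleton.mp hy
  obtain ⟨c, hc⟩ := h i
  rw [map_smul, hc]
  exact Submodule.smul_mem _ _ (Submodule.smul_mem _ _ (Submodule.mem_span_singleton_self x))

theorem sum_norm_sq (π : PRep n α H) (x : H) : ∑ i, ‖π.P i x‖ ^ 2 = α * ‖x‖ ^ 2 := by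
  have h1 : ∀ i, ‖π.P i x‖ ^ 2 = (inner ℂ x (π.P i x)).re := by
    intro i
    have h2 : π.P i (π.P i x) = π.P i x :=
      congrArg (fun T : H →L[ℂ] H => T x) (π.proj i).isIdempotentElem
    rw [← inner_self_eq_norm_sq (𝕜 := ℂ), inner_P, h2]
    rfl
  have h3 : ∑ i, π.P i x = (α : ℂ) • x := by
    simpa using congrArg (fun T : H →L[ℂ] H => T x) π.sum_eq
  rw [Finset.sum_congr rfl fun i _ => h1 i, ← Complex.re_sum, ← inner_sum, h3, inner_smul_right,
    Complex.re_ofReal_mul]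
  congr 1
  exact inner_self_eq_norm_sq (𝕜 := ℂ) x

theorem hasFiniteInvariant_zero : HasFiniteInvariant.{u} n 0 := by
  intro H _ _ _ _ π
  obtain ⟨x, hx⟩ := exists_ne (0 : H)
  refine π.exists_invariant_line hx fun i => ⟨0, ?_⟩
  have := π.sum_norm_sq x
  rw [zero_mul, Finset.sum_eq_zero_iff_of_nonneg fun _ _ => by positivity] at this
  simpa using this i (Finset.mem_univ i)

theorem hasFiniteInvariant_one : HasFiniteInvariant.{u} n 1 := by
  intro H _ _ _ _ π
  obtain ⟨y, hy⟩ := exists_ne (0 : H)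
  obtain ⟨j, hj⟩ : ∃ j, π.P j y ≠ 0 := by
    by_contra! h
    have := π.sum_norm_sq y
    simp only [h, norm_zero, one_mul] at this
    simp [eq_comm, hy] at this
  refine π.exists_invariant_line hj fun i => ?_
  have hjj : π.P j (π.P j y) = π.P j y :=
    congrArg (fun T : H →L[ℂ] H => T y) (π.proj j).isIdempotentElem
  by_cases hij : i = j
  · subst hij
    exact ⟨1, by rw [hjj, one_smul]⟩
  · refine ⟨0, ?_⟩
    have := π.sum_norm_sq (π.P j y)
    rw [← Finset.add_sum_erase _ _ (Finset.mem_univ j), hjj, one_mul, add_eq_left,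
      Finset.sum_eq_zero_iff_of_nonneg fun _ _ => by positivity] at this
    simpa using this i (by simp [hij])

/-- The representation `I - P_1, …, I - P_n` of `P_{n,n-α}`. -/
noncomputable def compl (π : PRep n α H) : PRep n (n - α) H where
  P i := 1 - π.P i
  proj i := (π.proj i).one_sub
  sum_eq := by
    rw [Finset.sum_sub_distrib, π.sum_eq]
    ext x
    simp [sub_smul, Nat.cast_smul_eq_nsmul]

theorem HasFiniteInvariant.compl (h : HasFiniteInvariant.{u} n α) :
    HasFiniteInvariant.{u} n (n - α) := by
  intro H _ _ _ hH π
  have h' : HasFiniteInvariant.{u} n (n - (n - α)) := by rwa [sub_sub_cancel]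
  obtain ⟨L, hL, hfin, hinv⟩ := h' H hH π.compl
  refine ⟨L, hL, hfin, fun i x hx => ?_⟩
  simpa [PRep.compl] using L.sub_mem hx (hinv i x hx)

/-! ### The hyperbolic reflection -/

section Hyperbolic

/-- The space of the reflected representation: the range of the projection
`E = I - (1 / α) Γ^* Γ`, encoded as the kernel of `Γ`. -/
noncomputable abbrev reflSpace (π : PRep n α H) : Submodule ℂ π.Sum :=
  LinearMap.ker (π.Gam : π.Sum →ₗ[ℂ] H)

instance (π : PRep n α H) : CompleteSpace π.reflSpace :=
  π.Gam.isClosed_ker.completeSpace_coe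

theorem gramProj_apply (π : PRep n α H) (x : π.Sum) :
    π.gramProj x = ((1 / α : ℝ) : ℂ) • adjoint π.Gam (π.Gam x) := rfl

theorem one_sub_gramProj_mem (π : PRep n α H) (hα : α ≠ 0) (x : π.Sum) :
    x - π.gramProj x ∈ π.reflSpace := by
  have hc : (α : ℂ) ≠ 0 := by exact_mod_cast hα
  rw [LinearMap.mem_ker, coe_coe, map_sub, gramProj_apply, map_smul, Gam_adjoint, smul_smul]
  simp [hc]

theorem gramProj_eq_zero (π : PRep n α H) (x : π.reflSpace) : π.gramProj x = 0 := by
  have : π.Gam x = 0 := x.2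
  rw [gramProj_apply, this, map_zero, smul_zero]

/-- The operator `(α / (α - 1)) E Q_i` on the range of `E = I - (1 / α) Γ^* Γ`. -/
noncomputable def reflProj (π : PRep n α H) (hα : α ≠ 0) (i : Fin n) :
    π.reflSpace →L[ℂ] π.reflSpace :=
  ((α / (α - 1) : ℝ) : ℂ) •
    (((1 - π.gramProj) ∘L π.coordProj i ∘L π.reflSpace.subtypeL).codRestrict π.reflSpace
      fun _ => π.one_sub_gramProj_mem hα _)

theorem coe_reflProj_apply (π : PRep n α H) (hα : α ≠ 0) (i : Fin n) (x : π.reflSpace) :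
    (π.reflProj hα i x : π.Sum) =
      ((α / (α - 1) : ℝ) : ℂ) • (π.coordProj i x - π.gramProj (π.coordProj i x)) := rfl

theorem coordProj_gramProj_coordProj (π : PRep n α H) (hα : α ≠ 0) (i : Fin n) (x : π.Sum) :
    π.coordProj i (π.gramProj (π.coordProj i x)) = ((1 / α : ℝ) : ℂ) • π.coordProj i x :=
  congrArg (fun T : π.Sum →L[ℂ] π.Sum => T x) ((π.functorF hα).compress i)

/-- The hyperbolic reflection of `π`, with parameter `α / (α - 1)`: the compressions of the `Q_i`
to the range of `E = I - (1 / α) Γ^* Γ`, rescaled to projections. They are projections because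
`Q_i E Q_i = (1 - 1 / α) Q_i`, and no positivity of `α / (α - 1)` is needed. -/
noncomputable def refl (π : PRep n α H) (hα : α ≠ 0) (hα1 : α ≠ 1) :
    PRep n (α / (α - 1)) π.reflSpace where
  P := π.reflProj hα
  proj i := by
    have hc : (α : ℂ) ≠ 0 := by exact_mod_cast hα
    have hc1 : (α : ℂ) - 1 ≠ 0 := by exact_mod_cast sub_ne_zero.mpr hα1
    constructor
    · refine ContinuousLinearMap.ext fun x => Subtype.ext ?_
      rw [mul_apply_eq_comp, coe_reflProj_apply, coe_reflProj_apply]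
      simp only [map_smul, map_sub, coordProj_gramProj_coordProj π hα, coordProj_coordProj, if_true]
      push_cast
      match_scalars <;> field_simp
    · refine isSelfAdjoint_iff_isSymmetric.mpr fun x y => ?_
      have hQ := isSelfAdjoint_iff_isSymmetric.mp ((π.functorF hα).projQ i).isSelfAdjoint
      have hG := isSelfAdjoint_iff_isSymmetric.mp (π.functorF hα).projP.isSelfAdjoint
      have hQ' : inner ℂ (π.coordProj i x) (y : π.Sum) = inner ℂ (x : π.Sum) (π.coordProj i y) :=
        hQ x y
      have hG' : ∀ a b : π.Sum, inner ℂ (π.gramProj a) b = inner ℂ a (π.gramProj b) :=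
        fun a b => hG a b
      rw [Submodule.coe_inner, Submodule.coe_inner, coe_coe, coe_reflProj_apply,
        coe_reflProj_apply, inner_smul_left, inner_smul_right, inner_sub_left, inner_sub_right,
        hG', ← hG' (x : π.Sum), gramProj_eq_zero, gramProj_eq_zero, inner_zero_left,
        inner_zero_right, hQ', Complex.conj_ofReal]
  sum_eq := by
    refine ContinuousLinearMap.ext fun x => Subtype.ext ?_
    rw [_root_.sum_apply, AddSubmonoidClass.coe_finsetSum]
    simp only [coe_reflProj_apply]
    rw [← Finset.smul_sum, Finset.sum_sub_distrib, ← map_sum, sum_coordProj π,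
      gramProj_eq_zero, sub_zero]
    rfl

theorem nontrivial_reflSpace [Nontrivial H] (π : PRep n α H) (hα : α ≠ 0) (hα1 : α ≠ 1) :
    Nontrivial π.reflSpace := by
  have hc : (α : ℂ) ≠ 0 := by exact_mod_cast hα
  by_contra hK
  rw [not_nontrivial_iff_subsingleton] at hK
  -- If `Γ` is injective then `(1 / α) Γ^* Γ = I`, which `Q_i P Q_i = (1 / α) Q_i` forbids.
  have hE : ∀ x, π.gramProj x = x := fun x =>
    (sub_eq_zero.mp (congrArg Subtype.val
      (Subsingleton.elim (⟨_, π.one_sub_gramProj_mem hα x⟩ : π.reflSpace) 0))).symm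
  have hQ : ∀ i x, π.coordProj i x = 0 := by
    intro i x
    have h := π.coordProj_gramProj_coordProj hα i x
    rw [hE, coordProj_coordProj, if_pos rfl] at h
    have h' : ((1 : ℂ) - ((1 / α : ℝ) : ℂ)) • π.coordProj i x = 0 := by
      rw [sub_smul, one_smul, ← h, sub_self]
    refine (smul_eq_zero.mp h').resolve_left fun h0 => hα1 ?_
    have : (1 : ℝ) - 1 / α = 0 := by exact_mod_cast h0
    field_simp at this
    linarith
  obtain ⟨x, hx⟩ := exists_ne (0 : H)
  have h0 : adjoint π.Gam x = 0 := by
    rw [← π.sum_coordProj (adjoint π.Gam x), Finset.sum_eq_zero fun i _ => hQ i _]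
  have := π.Gam_adjoint x
  rw [h0, map_zero] at this
  exact (smul_ne_zero hc hx) this.symm

/-- If `L` is an invariant subspace for the reflected representation, then the span of the
coordinates `x_i ∈ H_i` of the vectors `x ∈ L` is invariant for `π`. -/
theorem HasFiniteInvariant.of_refl (hα : α ≠ 0) (hα1 : α ≠ 1)
    (h : HasFiniteInvariant.{u} n (α / (α - 1))) : HasFiniteInvariant.{u} n α := by
  intro H _ _ _ _ π
  have hc : (α : ℂ) ≠ 0 := by exact_mod_cast hα
  have hc1 : (α : ℂ) - 1 ≠ 0 := by exact_mod_cast sub_ne_zero.mpr hα1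
  obtain ⟨L, hL, hfin, hinv⟩ := h _ (π.nontrivial_reflSpace hα hα1) (π.refl hα hα1)
  let f : Fin n → π.reflSpace →ₗ[ℂ] H := fun i =>
    ((π.im i).subtypeL ∘L PiLp.proj 2 (fun i : Fin n => π.im i) i ∘L π.reflSpace.subtypeL :
      π.reflSpace →L[ℂ] H)
  have hf : ∀ i x, f i x = ((x : π.Sum) i : H) := fun _ _ => rfl
  refine ⟨⨆ i, L.map (f i), ?_, inferInstance, ?_⟩
  · obtain ⟨x, hx, hx0⟩ := Submodule.exists_mem_ne_zero_of_ne_bot hL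
    intro hbot
    refine hx0 (Subtype.ext (PiLp.ext fun i => Subtype.ext ?_))
    have : f i x ∈ ⨆ i, L.map (f i) := Submodule.mem_iSup_of_mem i (Submodule.mem_map_of_mem hx)
    rwa [hbot, Submodule.mem_bot, hf] at this
  · intro j y hy
    induction hy using Submodule.iSup_induction' with
    | zero => rw [map_zero]; exact Submodule.zero_mem _
    | add y z _ _ hy hz => rw [map_add]; exact Submodule.add_mem _ hy hz
    | mem i y hy =>
      obtain ⟨x, hx, rfl⟩ := hy
      -- With `z = (α / (α - 1)) E Q_i x ∈ L`, the `j`-th coordinate of `Γ^* Γ Q_i x` is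
      -- `α δ_{ij} x_i - (α - 1) z_j`.
      have hz := hinv i x hx
      have hG : π.Gam (π.coordProj i x) = ((x : π.Sum) i : H) := by
        rw [Gam_apply]
        simp only [coordProj_apply]
        rw [Finset.sum_eq_single i] <;> simp +contextual
      have key : π.P j (f i x) =
          (α : ℂ) • ((π.coordProj i x) j : H) - ((α : ℂ) - 1) • f j (π.reflProj hα i x) := by
        rw [hf, hf, coe_reflProj_apply, ← hG, ← adjoint_Gam_apply, gramProj_apply]
        simp only [PiLp.smul_apply, PiLp.sub_apply, Submodule.coe_smul, Submodule.coe_sub]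
        push_cast
        match_scalars <;> field_simp
        ring
      rw [key]
      refine Submodule.sub_mem _ (Submodule.smul_mem _ _ ?_) (Submodule.smul_mem _ _ ?_)
      · rw [coordProj_apply]
        split_ifs with hj
        · exact Submodule.mem_iSup_of_mem j (Submodule.mem_map_of_mem (f := f j) hx)
        · exact Submodule.zero_mem _
      · exact Submodule.mem_iSup_of_mem j (Submodule.mem_map_of_mem hz)

end Hyperbolic

/-! ### The discrete spectrum -/

/-- The composite of the two reflections carries the parameter `α` to `1 + 1 / (n - 1 - α)`. The
degenerate parameters need no exclusion: if the denominator vanishes the new parameter is `1`. -/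
theorem HasFiniteInvariant.coxeter (h : HasFiniteInvariant.{u} n α) :
    HasFiniteInvariant.{u} n (1 + 1 / (n - 1 - α)) := by
  by_cases hy : (n : ℝ) - 1 - α = 0
  · rw [hy, div_zero, add_zero]
    exact hasFiniteInvariant_one
  by_cases h0 : 1 + 1 / ((n : ℝ) - 1 - α) = 0
  · rw [h0]
    exact hasFiniteInvariant_zero
  · refine .of_refl h0 (by simpa using hy) ?_
    convert h.compl using 1
    field_simp
    ring

theorem hasFiniteInvariant_contFrac {b : ℝ} (h : HasFiniteInvariant.{u} n (1 + 1 / b)) (k : ℕ) :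
    HasFiniteInvariant.{u} n (1 + 1 / contFrac n b k) := by
  induction k with
  | zero => exact h
  | succ k ih =>
    convert ih.coxeter using 3
    rw [contFrac]
    ring

theorem hasFiniteInvariant_of_mem_Lambda0 (h : α ∈ Lambda0 n) : HasFiniteInvariant.{u} n α := by
  rcases h with rfl | ⟨k, rfl⟩
  · exact hasFiniteInvariant_zero
  · refine hasFiniteInvariant_contFrac ?_ k
    simpa using (hasFiniteInvariant_zero (n := n)).coxeter

theorem hasFiniteInvariant_of_mem_Lambda1 (h : α ∈ Lambda1 n) : HasFiniteInvariant.{u} n α := by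
  rcases h with rfl | ⟨k, rfl⟩
  · exact hasFiniteInvariant_one
  · refine hasFiniteInvariant_contFrac ?_ k
    convert (hasFiniteInvariant_one (n := n)).coxeter using 3
    ring

theorem hasFiniteInvariant_of_mem_discreteSpectrum (h : α ∈ discreteSpectrum n) :
    HasFiniteInvariant.{u} n α := by
  have hc : HasFiniteInvariant.{u} n (n - α) → HasFiniteInvariant.{u} n α := fun h => by
    simpa using h.compl
  unfold discreteSpectrum at h
  split_ifs at h with h2 h3
  · subst h2
    rcases h with rfl | rfl | rfl
    · exact hasFiniteInvariant_zero
    · exact hasFiniteInvariant_one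
    · exact hc (by simpa using hasFiniteInvariant_zero)
  · subst h3
    rcases h with rfl | rfl | rfl | rfl | rfl
    · exact hasFiniteInvariant_zero
    · exact hasFiniteInvariant_one
    · convert (hasFiniteInvariant_zero (n := 3)).coxeter using 1
      norm_num
    · refine hc ?_
      convert hasFiniteInvariant_one (n := 3) using 1
      norm_num
    · exact hc (by simpa using hasFiniteInvariant_zero)
  · rcases h with h | h | h | h
    · exact hasFiniteInvariant_of_mem_Lambda0 h
    · exact hasFiniteInvariant_of_mem_Lambda1 h
    · exact hc (hasFiniteInvariant_of_mem_Lambda1 h)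
    · exact hc (hasFiniteInvariant_of_mem_Lambda0 h)

end FiniteInvariant

end PRep
end SubspaceSystems

open SubspaceSystems in
theorem theorem4 (n : ℕ) (hn : 2 ≤ n) :
    (∀ (α : ℝ) (_ : α ∈ discreteSpectrum n) (hα : α ≠ 0)
        (H : Type*) [NormedAddCommGroup H] [InnerProductSpace ℂ H] [CompleteSpace H]
        (π : PRep n α H), π.IsIrreducible →
        IsTransitive (π.functorF hα).system) ∧
    (∀ (α β : ℝ) (_ : α ∈ discreteSpectrum n) (_ : β ∈ discreteSpectrum n)
        (hα : α ≠ 0) (hβ : β ≠ 0)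
        (H : Type*) [NormedAddCommGroup H] [InnerProductSpace ℂ H] [CompleteSpace H]
        (H' : Type*) [NormedAddCommGroup H'] [InnerProductSpace ℂ H'] [CompleteSpace H']
        (π : PRep n α H) (π' : PRep n β H'), π.IsIrreducible → π'.IsIrreducible →
        ¬ π.Equivalent π' →
        ¬ SystemIso (π.functorF hα).system (π'.functorF hβ).system) := by
  refine ⟨fun α h hα H _ _ _ π hπ => ?_,
    fun α β h h' hα hβ H _ _ _ H' _ _ _ π π' hπ hπ' hne hiso => hne ?_⟩
  · have := (PRep.hasFiniteInvariant_of_mem_discreteSpectrum h).finiteDimensional hπ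
    exact hπ.isTransitive hα
  · have := (PRep.hasFiniteInvariant_of_mem_discreteSpectrum h).finiteDimensional hπ
    have := (PRep.hasFiniteInvariant_of_mem_discreteSpectrum h').finiteDimensional hπ'
    exact PRep.equivalent_of_systemIso hπ hπ' hiso
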